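/- **Theorem.** Let $n$ be a positive integer and $\lambda>0$. Let $\mathbb A^{(\lambda)}(\mathbb D^n)$ be the Hilbert space of functions on the polydisc $\mathbb D^n\subset\mathbb C^n$ with reproducing kernel $K^{(\lambda)}(z,w)=\prod_{j=1}^n(1-z_j\bar w_j)^{-\lambda}$, regarded as a Hilbert module over the ring $\mathbb C[z]^{\mathfrak S_n}$ of symmetric polynomials under pointwise multiplication. The symmetric group $\mathfrak S_n$ acts on functions by $(f\circ\sigma^{-1})(z)=f(z_{\sigma(1)},\dots,z_{\sigma(n)})$. For each partition $p$ of $n$ let $\pi_p=(\pi_p^{ij})$ be an irreducible unitary matrix representation of $\mathfrak S_n$ in the equivalence class labelled by $p$, under the one-to-one correspondence between partitions of $n$ and equivalence classes of irreducible representations of $\mathfrak S_n$; thus $\pi_p$ may be any irreducible unitary matrix representation of $\mathfrak S_n$. Let $\chi_p(\sigma)=\operatorname{trace}\pi_p(\sigma)$ be its character, so that $\chi_p(1)$ is the size of the matrices. For $f\in\mathbb A^{(\lambda)}(\mathbb D^n)$ and $1\le i,j\le\chi_p(1)$ put $$\mathbb P_p^{ij}f=\frac{\chi_p(1)}{n!}\sum_{\sigma\in\mathfrak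 S_n}\pi_p^{ji}(\sigma^{-1})\,(f\circ\sigma^{-1}),\qquad \mathbb P_pf=\frac{\chi_p(1)}{n!}\sum_{\sigma\in\mathfrak S_n}\overline{\chi_p(\sigma)}\,(f\circ\sigma^{-1}).$$ The ranges of $\mathbb P_p^{ii}$ and of $\mathbb P_p$ are sub-modules of $\mathbb A^{(\lambda)}(\mathbb D^n)$ over $\mathbb C[z]^{\mathfrak S_n}$. Two Hilbert modules are called equivalent if there is a unitary map between them that intertwines the module actions. Let $p$ and $q$ be partitions of $n$ with $\chi_p(1)\neq\chi_q(1)$. Then (a) the sub-modules $\mathbb P_p^{ii}\big(\mathbb A^{(\lambda)}(\mathbb D^n)\big)$ and $\mathbb P_q^{jj}\big(\mathbb A^{(\lambda)}(\mathbb D^n)\big)$ are not equivalent for any $i,j$ with $1\le i\le\chi_p(1)$ and $1\le j\le\chi_q(1)$; (b) the sub-modules $\mathbb P_p\big(\mathbb A^{(\lambda)}(\mathbb D^n)\big)$ and $\mathbb P_q\big(\mathbb A^{(\lambda)}(\mathbb D^n)\big)$ are not equivalent. -/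

import Mathlib

/-! ## Hilbert modules -/

/-- A Hilbert module structure over the `ℂ`-algebra `R` on the Hilbert space `H`:
a unital algebra homomorphism `r ↦ T_r` into the bounded operators on `H`. -/
abbrev HilbertModule (R : Type*) [CommRing R] [Algebra ℂ R] (H : Type*)
    [NormedAddCommGroup H] [InnerProductSpace ℂ H] : Type _ :=
  R →ₐ[ℂ] (H →L[ℂ] H)

namespace HilbertModule

variable {R : Type*} [CommRing R] [Algebra ℂ R]
  {H₁ : Type*} [NormedAddCommGroup H₁] [InnerProductSpace ℂ H₁]
  {H₂ : Type*} [NormedAddCommGroup H₂] [InnerProductSpace ℂ H₂]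

/-- (Unitary) equivalence of Hilbert modules: there is a unitary module map between them. -/
def Equivalent (T₁ : HilbertModule R H₁) (T₂ : HilbertModule R H₂) : Prop :=
  ∃ U : H₁ ≃ₗᵢ[ℂ] H₂, ∀ (r : R) (h : H₁), U (T₁ r h) = T₂ r (U h)

/-- The sub-module structure on an invariant subspace `S`, given by restricting the action. -/
def restrict (T : HilbertModule R H₁) (S : Submodule ℂ H₁)
    (hS : ∀ (r : R), ∀ h ∈ S, T r h ∈ S) : HilbertModule R S where
  toFun r := ((T r).comp S.subtypeL).codRestrict S fun h => hS r h h.2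
  map_one' := by ext h; simp
  map_mul' r s := by
    ext h
    exact congrArg (fun A : H₁ →L[ℂ] H₁ => A h) (map_mul T r s)
  map_zero' := by ext h; simp
  map_add' r s := by
    ext h
    exact congrArg (fun A : H₁ →L[ℂ] H₁ => A h) (map_add T r s)
  commutes' c := by ext h; simp [Algebra.algebraMap_eq_smul_one]

@[simp]
theorem coe_restrict_apply (T : HilbertModule R H₁) (S : Submodule ℂ H₁)
    (hS : ∀ (r : R), ∀ h ∈ S, T r h ∈ S) (r : R) (h : S) :
    (T.restrict S hS r h : H₁) = T r h := rfl

end HilbertModule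

namespace PolydiscBergman

open Complex MvPolynomial
open scoped ComplexConjugate

/-! ## The kernel `∏ j, (1 - z j * conj (w j)) ^ (-lam)` and its positivity -/

/-- The polydisc `𝔻ⁿ` in `ℂⁿ`. -/
abbrev Polydisc (n : ℕ) : Type := Fin n → UnitDisc

/-- The kernel `∏ j, (1 - z j * conj (w j)) ^ (-lam)` on the polydisc (principal branch; the real
part of `1 - z j * conj (w j)` is positive). -/
noncomputable def bergmanKernel (n : ℕ) (lam : ℝ) (z w : Polydisc n) : ℂ :=
  ∏ j, (1 - (z j : ℂ) * conj (w j : ℂ)) ^ (-(lam : ℂ))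

/-- Nonnegativity of the quadratic form of a scalar kernel. -/
def IsPD {X : Type*} (k : X → X → ℂ) : Prop :=
  ∀ c : X →₀ ℂ, 0 ≤ (∑ x ∈ c.support, ∑ y ∈ c.support, conj (c x) * c y * k x y).re

theorem isPD_one {X : Type*} : IsPD (fun _ _ : X => (1 : ℂ)) := by
  intro c
  have : (∑ x ∈ c.support, ∑ y ∈ c.support, conj (c x) * c y * 1)
      = conj (∑ x ∈ c.support, c x) * ∑ x ∈ c.support, c x := by
    simp [Finset.sum_mul_sum]
  rw [this, ← normSq_eq_conj_mul_self, ofReal_re]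
  exact normSq_nonneg _

theorem IsPD.mul_rankOne {X : Type*} {k : X → X → ℂ} (hk : IsPD k) (g : X → ℂ) :
    IsPD (fun x y => (g x * conj (g y)) * k x y) := by
  classical
  intro c
  set d : X →₀ ℂ := Finsupp.onFinset c.support (fun x => c x * conj (g x))
    (fun x hx => by simp only [Finsupp.mem_support_iff]; exact left_ne_zero_of_mul hx) with hd
  have hsub : d.support ⊆ c.support := Finsupp.support_onFinset_subset
  have := hk d
  convert this using 2
  symm
  have e1 : ∀ x, ∑ y ∈ d.support, conj (d x) * d y * k x y
      = ∑ y ∈ c.support, conj (d x) * d y * k x y := fun x =>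
    Finset.sum_subset hsub fun y _ hy => by
      rw [Finsupp.notMem_support_iff.1 hy]; simp
  simp_rw [e1]
  rw [Finset.sum_subset hsub fun x _ hx => by
      rw [Finsupp.notMem_support_iff.1 hx]; simp]
  refine Finset.sum_congr rfl fun x _ => Finset.sum_congr rfl fun y _ => ?_
  simp only [hd, Finsupp.onFinset_apply, map_mul, conj_conj]
  ring

/-- Multiplying by a convergent series in `g x * conj (g y)` with nonnegative coefficients
preserves positivity. -/
theorem IsPD.mul_series {X : Type*} {k : X → X → ℂ} (hk : IsPD k) (g : X → ℂ) {a : ℕ → ℝ}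
    (ha : ∀ m, 0 ≤ a m) {s : X → X → ℂ}
    (hs : ∀ x y, HasSum (fun m => (a m : ℂ) * (g x * conj (g y)) ^ m) (s x y)) :
    IsPD (fun x y => s x y * k x y) := by
  intro c
  have h1 : HasSum (fun m => ∑ x ∈ c.support, ∑ y ∈ c.support,
      conj (c x) * c y * (((a m : ℂ) * (g x * conj (g y)) ^ m) * k x y))
      (∑ x ∈ c.support, ∑ y ∈ c.support, conj (c x) * c y * (s x y * k x y)) :=
    hasSum_sum fun x _ => hasSum_sum fun y _ => ((hs x y).mul_right _).mul_left _
  have h2 := Complex.hasSum_re h1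
  refine h2.nonneg fun m => ?_
  have h3 := hk.mul_rankOne (fun x => g x ^ m) c
  have h4 : (∑ x ∈ c.support, ∑ y ∈ c.support,
      conj (c x) * c y * (((a m : ℂ) * (g x * conj (g y)) ^ m) * k x y))
      = (a m : ℂ) * ∑ x ∈ c.support, ∑ y ∈ c.support,
        conj (c x) * c y * ((g x ^ m * conj (g y ^ m)) * k x y) := by
    rw [Finset.mul_sum]
    refine Finset.sum_congr rfl fun x _ => ?_
    rw [Finset.mul_sum]
    refine Finset.sum_congr rfl fun y _ => ?_
    rw [map_pow, mul_pow]; ring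
  simp only [h4, re_ofReal_mul]
  exact mul_nonneg (ha m) h3

/-- The coefficients `(lam)_m / m!` of `(1 - x) ^ (-lam)`. -/
noncomputable def binCoeff (lam : ℝ) (m : ℕ) : ℝ := (ascPochhammer ℝ m).eval lam / m.factorial

theorem binCoeff_nonneg {lam : ℝ} (h : 0 < lam) (m : ℕ) : 0 ≤ binCoeff lam m :=
  div_nonneg (ascPochhammer_pos m lam h).le (Nat.cast_nonneg _)

theorem binCoeff_succ (lam : ℝ) (m : ℕ) :
    (m + 1) * binCoeff lam (m + 1) = (lam + m) * binCoeff lam m := by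
  have : ((m.factorial : ℕ) : ℝ) ≠ 0 := Nat.cast_ne_zero.2 (Nat.factorial_ne_zero m)
  have : (m : ℝ) + 1 ≠ 0 := by positivity
  simp only [binCoeff, ascPochhammer_succ_eval, Nat.factorial_succ]
  push_cast
  field_simp

theorem hasSum_binCoeff (lam : ℝ) {x : ℂ} (hx : ‖x‖ < 1) :
    HasSum (fun m => (binCoeff lam m : ℂ) * x ^ m) ((1 - x) ^ (-(lam : ℂ))) := by
  have h := (Complex.one_div_one_sub_cpow_hasFPowerSeriesOnBall_zero (lam : ℂ)).hasSum
    (y := x) (by simpa [enorm_eq_nnnorm, ← NNReal.coe_lt_coe] using hx)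
  rw [zero_add, one_div, ← cpow_neg] at h
  have e : (fun m => (binCoeff lam m : ℂ) * x ^ m) = fun m =>
      (FormalMultilinearSeries.ofScalars ℂ fun n : ℕ => Ring.choose ((lam : ℂ) + n - 1) n) m
        fun _ => x := by
    ext m
    rw [FormalMultilinearSeries.ofScalars_apply_eq, smul_eq_mul]
    congr 1
    have h1 : ((lam : ℂ) + m - 1) = ((lam + m - 1 : ℝ) : ℂ) := by push_cast; ring
    rw [h1, ← Complex.ofReal_choose, Ring.choose]
    congr 1
    have h2 := Ring.factorial_nsmul_multichoose_eq_ascPochhammer lam m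
    rw [Polynomial.ascPochhammer_smeval_eq_eval, nsmul_eq_mul] at h2
    have : ((m.factorial : ℕ) : ℝ) ≠ 0 := Nat.cast_ne_zero.2 (Nat.factorial_ne_zero m)
    rw [binCoeff, ← h2, mul_div_cancel_left₀ _ this]
    congr 1
    ring
  rw [e]
  exact h

theorem norm_mul_conj_lt_one (z w : UnitDisc) : ‖(z : ℂ) * conj (w : ℂ)‖ < 1 := by
  rw [norm_mul, norm_conj]
  exact mul_lt_one_of_nonneg_of_lt_one_left (norm_nonneg _) z.norm_lt_one w.norm_lt_one.le

theorem isPD_finsetProd {n : ℕ} {lam : ℝ} (h : 0 < lam) (s : Finset (Fin n)) :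
    IsPD (fun z w : Polydisc n => ∏ j ∈ s, (1 - (z j : ℂ) * conj (w j : ℂ)) ^ (-(lam : ℂ))) := by
  classical
  induction s using Finset.induction_on with
  | empty => simpa using isPD_one
  | insert j s hj ih =>
    simp_rw [Finset.prod_insert hj]
    exact ih.mul_series (fun z => (z j : ℂ)) (binCoeff_nonneg h)
      fun z w => hasSum_binCoeff lam (norm_mul_conj_lt_one _ _)

theorem isPD_bergmanKernel {n : ℕ} {lam : ℝ} (h : 0 < lam) : IsPD (bergmanKernel n lam) :=
  isPD_finsetProd h Finset.univ

/-- Positivity behind the boundedness of multiplication by a coordinate function. -/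
theorem isPD_sub_mul_bergmanKernel {n : ℕ} {lam : ℝ} (h : 0 < lam) (i : Fin n) :
    IsPD (fun z w => ((1 + 1 / lam : ℝ) - (z i : ℂ) * conj (w i : ℂ)) * bergmanKernel n lam z w) := by
  classical
  set C : ℝ := 1 + 1 / lam with hC
  set a : ℕ → ℝ := fun m => C * binCoeff lam m - (if m = 0 then 0 else binCoeff lam (m - 1)) with ha
  have ha0 : ∀ m, 0 ≤ a m := by
    rintro (_ | m)
    · have := binCoeff_nonneg h 0
      simp only [ha, if_true, sub_zero]
      positivity
    · have h1 := binCoeff_succ lam m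
      have h2 := binCoeff_nonneg h m
      have h3 : (0 : ℝ) < m + 1 := by positivity
      have h4 : ((m : ℝ) + 1) * (C * binCoeff lam (m + 1) - binCoeff lam m)
          = (C * (lam + m) - (m + 1)) * binCoeff lam m := by
        linear_combination C * h1
      have h5 : 0 ≤ C * (lam + m) - (m + 1) := by
        have : C * (lam + m) - (m + 1) = lam + m / lam := by rw [hC]; field_simp; ring
        rw [this]; positivity
      have h6 : 0 ≤ ((m : ℝ) + 1) * (C * binCoeff lam (m + 1) - binCoeff lam m) := by
        rw [h4]; exact mul_nonneg h5 h2
      simpa [ha] using nonneg_of_mul_nonneg_right h6 h3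
  have hs : ∀ z w : Polydisc n, HasSum
      (fun m => (a m : ℂ) * ((z i : ℂ) * conj (w i : ℂ)) ^ m)
      (((C : ℂ) - (z i : ℂ) * conj (w i : ℂ)) *
        (1 - (z i : ℂ) * conj (w i : ℂ)) ^ (-(lam : ℂ))) := by
    intro z w
    set x : ℂ := (z i : ℂ) * conj (w i : ℂ) with hx
    have h1 := hasSum_binCoeff lam (norm_mul_conj_lt_one (z i) (w i))
    rw [← hx] at h1
    have h2 : HasSum (fun m : ℕ => ((if m = 0 then 0 else binCoeff lam (m - 1) : ℝ) : ℂ) * x ^ m)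
        (x * (1 - x) ^ (-(lam : ℂ))) := by
      rw [← hasSum_nat_add_iff' 1]
      simp only [Finset.range_one, Finset.sum_singleton, if_true, ofReal_zero, zero_mul, sub_zero,
        Nat.add_eq_zero_iff, one_ne_zero, and_false, if_false, Nat.add_sub_cancel]
      have e : (fun m => (binCoeff lam m : ℂ) * x ^ (m + 1))
          = fun m => x * ((binCoeff lam m : ℂ) * x ^ m) := by ext m; rw [pow_succ]; ring
      rw [e]
      exact h1.mul_left x
    have e : (fun m => (a m : ℂ) * x ^ m) = fun m => (C : ℂ) * ((binCoeff lam m : ℂ) * x ^ m)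
        - ((if m = 0 then 0 else binCoeff lam (m - 1) : ℝ) : ℂ) * x ^ m := by
      ext m; simp only [ha]; rw [ofReal_sub, ofReal_mul]; ring
    rw [e, sub_mul]
    exact (h1.mul_left (C : ℂ)).sub h2
  have := (isPD_finsetProd h (Finset.univ.erase i)).mul_series
    (fun z : Polydisc n => (z i : ℂ)) ha0 hs
  convert this using 3 with z w
  rw [bergmanKernel, ← Finset.mul_prod_erase _ _ (Finset.mem_univ i), mul_assoc]

theorem bergmanKernel_symm (n : ℕ) (lam : ℝ) (z w : Polydisc n) :
    conj (bergmanKernel n lam z w) = bergmanKernel n lam w z := by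
  rw [bergmanKernel, bergmanKernel, map_prod]
  refine Finset.prod_congr rfl fun j _ => ?_
  have h1 : (1 - (z j : ℂ) * conj (w j : ℂ)).arg ≠ Real.pi := by
    refine (Complex.mem_slitPlane_iff_arg.1 ?_).1
    have := Complex.mem_slitPlane_of_norm_lt_one
      (z := -((z j : ℂ) * conj (w j : ℂ))) (by rw [norm_neg]; exact norm_mul_conj_lt_one _ _)
    rwa [← sub_eq_add_neg] at this
  have := Complex.conj_cpow (1 - (z j : ℂ) * conj (w j : ℂ)) (-(lam : ℂ)) h1
  simp only [map_sub, map_one, map_mul, conj_conj, map_neg, conj_ofReal] at this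
  rw [← this, mul_comm]

/-- The kernel as a matrix of operators on `ℂ`. -/
noncomputable def bergmanMatrix (n : ℕ) (lam : ℝ) :
    Matrix (Polydisc n) (Polydisc n) (ℂ →L[ℂ] ℂ) :=
  .of fun z w => bergmanKernel n lam z w • ContinuousLinearMap.id ℂ ℂ

open scoped ComplexOrder in
instance bergmanMatrix_posSemidef (n : ℕ) (lam : ℝ) [h : Fact (0 < lam)] :
    Fact (bergmanMatrix n lam).PosSemidef := by
  have key := (RKHS.posSemidef_tfae (K := bergmanMatrix n lam)).out 0 2
  refine ⟨key.2 ?_⟩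
  refine ⟨?_, fun c => ?_⟩
  · ext z w
    simp [bergmanMatrix, Matrix.conjTranspose_apply, ContinuousLinearMap.star_eq_adjoint,
      bergmanKernel_symm, ContinuousLinearMap.adjoint_id]
  · have e : (c.sum fun w a => c.sum fun z b => inner ℂ (bergmanMatrix n lam z w a) b)
        = ∑ w ∈ c.support, ∑ z ∈ c.support, conj (c w) * c z * bergmanKernel n lam w z := by
      simp only [Finsupp.sum, bergmanMatrix, Matrix.of_apply]
      refine Finset.sum_congr rfl fun w _ => Finset.sum_congr rfl fun z _ => ?_
      simp [bergmanKernel_symm]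
      ring
    rw [e]
    exact isPD_bergmanKernel (n := n) h.out c

/-! ## The weighted Bergman space -/

/-- The weighted Bergman space `𝔸^(lam)(𝔻ⁿ)`: the reproducing kernel Hilbert space of functions
on the polydisc with kernel `∏ j, (1 - z j * conj (w j)) ^ (-lam)`. -/
abbrev BergmanSpace (n : ℕ) (lam : ℝ) [Fact (0 < lam)] : Type :=
  RKHS.OfKernel (bergmanMatrix n lam)

theorem kernel_bergmanSpace (n : ℕ) (lam : ℝ) [Fact (0 < lam)] (z w : Polydisc n) (v : ℂ) :
    RKHS.kernel (BergmanSpace n lam) z w v = bergmanKernel n lam z w * v := by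
  rw [RKHS.OfKernel.kernel_ofKernel]
  simp [bergmanMatrix]

/-! ### Bounded operators on the weighted Bergman space -/

theorem inner_linearCombination_kerFun {X H : Type*} [NormedAddCommGroup H]
    [InnerProductSpace ℂ H] [CompleteSpace H] [RKHS ℂ H X ℂ] (a : X → ℂ) (ψ : X → X)
    (c : X →₀ ℂ) :
    ((‖Finsupp.linearCombination ℂ (fun x => a x • RKHS.kerFun H (ψ x) 1) c‖ ^ 2 : ℝ) : ℂ)
      = ∑ x ∈ c.support, ∑ y ∈ c.support, conj (c x) * c y *
        (conj (a x) * a y * RKHS.kernel H (ψ x) (ψ y) 1) := by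
  rw [ofReal_pow]
  refine (inner_self_eq_norm_sq_to_K (𝕜 := ℂ) (E := H) _).symm.trans ?_
  rw [Finsupp.linearCombination_apply,
    Finsupp.sum, sum_inner]
  refine Finset.sum_congr rfl fun x _ => ?_
  rw [inner_sum]
  refine Finset.sum_congr rfl fun y _ => ?_
  rw [inner_smul_left, inner_smul_left, inner_smul_right, inner_smul_right, RKHS.kerFun_inner,
    RKHS.kerFun_apply]
  simp
  ring

/-- Existence of bounded weighted composition operators `f ↦ u · (f ∘ ψ)`. -/
theorem exists_weightedComp {X H : Type*} [NormedAddCommGroup H]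
    [InnerProductSpace ℂ H] [CompleteSpace H] [RKHS ℂ H X ℂ] (u : X → ℂ) (ψ : X → X) (C : ℝ)
    (hC : 0 ≤ C)
    (hpd : IsPD fun x y => (C : ℂ) * RKHS.kernel H x y 1
      - u x * conj (u y) * RKHS.kernel H (ψ x) (ψ y) 1) :
    ∃ M : H →L[ℂ] H, ∀ f x, M f x = u x * f (ψ x) := by
  set e : (X →₀ ℂ) →ₗ[ℂ] H := Finsupp.linearCombination ℂ (fun x => RKHS.kerFun H x 1) with he
  set t : (X →₀ ℂ) →ₗ[ℂ] H :=
    Finsupp.linearCombination ℂ (fun x => conj (u x) • RKHS.kerFun H (ψ x) 1) with ht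
  have hbound : ∀ c, ‖t c‖ ≤ √C * ‖e c‖ := by
    intro c
    have h1 := inner_linearCombination_kerFun (H := H) (fun x => conj (u x)) ψ c
    have h2 := inner_linearCombination_kerFun (H := H) (fun _ => 1) (fun x : X => x) c
    simp only [one_smul] at h2
    have h3 := hpd c
    have h4 : (∑ x ∈ c.support, ∑ y ∈ c.support, conj (c x) * c y *
        ((C : ℂ) * RKHS.kernel H x y 1 - u x * conj (u y) * RKHS.kernel H (ψ x) (ψ y) 1))
        = ((C * ‖e c‖ ^ 2 - ‖t c‖ ^ 2 : ℝ) : ℂ) := by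
      rw [ofReal_sub, ofReal_mul, h1, h2, Finset.mul_sum, ← Finset.sum_sub_distrib]
      refine Finset.sum_congr rfl fun x _ => ?_
      rw [Finset.mul_sum, ← Finset.sum_sub_distrib]
      refine Finset.sum_congr rfl fun y _ => ?_
      simp
      ring
    rw [h4, ofReal_re] at h3
    refine abs_le_of_sq_le_sq' ?_ (by positivity) |>.2
    rw [mul_pow, Real.sq_sqrt hC]
    linarith
  have hdense : DenseRange e := by
    have h1 := RKHS.kerFun_dense (𝕜 := ℂ) H
    rw [DenseRange, ← LinearMap.coe_range, Submodule.dense_iff_topologicalClosure_eq_top,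
      eq_top_iff, ← h1]
    refine Submodule.topologicalClosure_mono (Submodule.span_le.2 ?_)
    rintro _ ⟨x, v, rfl⟩
    refine ⟨Finsupp.single x v, ?_⟩
    rw [he, Finsupp.linearCombination_single, ← map_smul, smul_eq_mul, mul_one]
  set T : H →L[ℂ] H := t.extendOfNorm e
  have hT : ∀ x, T (RKHS.kerFun H x 1) = conj (u x) • RKHS.kerFun H (ψ x) 1 := by
    intro x
    have := LinearMap.extendOfNorm_eq (f := t) hdense ⟨_, hbound⟩ (Finsupp.single x 1)
    simpa [he, ht] using this
  refine ⟨T.adjoint, fun f x => ?_⟩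
  have h1 : ∀ (g : H) (y : X), inner ℂ (RKHS.kerFun H y 1) g = g y := by
    intro g y; rw [RKHS.kerFun_inner]; simp
  rw [← h1, ContinuousLinearMap.adjoint_inner_right, hT, inner_smul_left, h1, conj_conj]

variable {n : ℕ} {lam : ℝ} [Fact (0 < lam)]

/-- Every polynomial multiplies the weighted Bergman space boundedly into itself. -/
theorem exists_mulOp (p : MvPolynomial (Fin n) ℂ) :
    ∃ M : BergmanSpace n lam →L[ℂ] BergmanSpace n lam,
      ∀ f z, M f z = eval (fun i => (z i : ℂ)) p * f z := by
  induction p using MvPolynomial.induction_on with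
  | C a => exact ⟨a • ContinuousLinearMap.id ℂ _, fun f z => by simp⟩
  | add p q hp hq =>
    obtain ⟨M, hM⟩ := hp
    obtain ⟨N, hN⟩ := hq
    exact ⟨M + N, fun f z => by simp [hM, hN, add_mul]⟩
  | mul_X p i hp =>
    obtain ⟨M, hM⟩ := hp
    have hlam : 0 < lam := Fact.out
    obtain ⟨N, hN⟩ := exists_weightedComp (H := BergmanSpace n lam)
      (fun z : Polydisc n => (z i : ℂ)) (fun z => z) (1 + 1 / lam) (by positivity) (by
        have := isPD_sub_mul_bergmanKernel (n := n) hlam i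
        simpa only [kernel_bergmanSpace, mul_one, sub_mul] using this)
    exact ⟨M.comp N, fun f z => by simp [hM, hN, mul_assoc]⟩

/-- Multiplication `f ↦ p · f` by the polynomial `p`, as a bounded operator. -/
noncomputable def mulOp (p : MvPolynomial (Fin n) ℂ) :
    BergmanSpace n lam →L[ℂ] BergmanSpace n lam :=
  (exists_mulOp p).choose

@[simp]
theorem mulOp_apply (p : MvPolynomial (Fin n) ℂ) (f : BergmanSpace n lam) (z : Polydisc n) :
    mulOp p f z = eval (fun i => (z i : ℂ)) p * f z :=
  (exists_mulOp p).choose_spec f z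

theorem exists_permOp (σ : Equiv.Perm (Fin n)) :
    ∃ M : BergmanSpace n lam →L[ℂ] BergmanSpace n lam, ∀ f z, M f z = f (z ∘ σ) := by
  obtain ⟨N, hN⟩ := exists_weightedComp (H := BergmanSpace n lam)
      (fun _ : Polydisc n => 1) (fun z => z ∘ σ) 1 zero_le_one (by
        intro c
        have : ∀ z w : Polydisc n, bergmanKernel n lam (z ∘ σ) (w ∘ σ) = bergmanKernel n lam z w :=
          fun z w => Equiv.prod_comp σ
            (fun j => (1 - (z j : ℂ) * conj (w j : ℂ)) ^ (-(lam : ℂ)))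
        simp only [kernel_bergmanSpace, this]
        simp)
  exact ⟨N, fun f z => by simp [hN]⟩

/-- The operator `R_σ f = f ∘ σ⁻¹`, where `σ • z = (z_{σ⁻¹(1)}, …, z_{σ⁻¹(n)})` is the natural
action of the symmetric group; thus `(R_σ f) z = f (σ⁻¹ • z) = f (z_{σ(1)}, …, z_{σ(n)})`. -/
noncomputable def permOp (σ : Equiv.Perm (Fin n)) :
    BergmanSpace n lam →L[ℂ] BergmanSpace n lam :=
  (exists_permOp σ).choose

@[simp]
theorem permOp_apply (σ : Equiv.Perm (Fin n)) (f : BergmanSpace n lam) (z : Polydisc n) :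
    permOp σ f z = f (z ∘ σ) :=
  (exists_permOp σ).choose_spec f z

/-- The ring `ℂ[z]^{𝔖ₙ}` of symmetric polynomials. -/
abbrev SymPoly (n : ℕ) : Type := symmetricSubalgebra (Fin n) ℂ

/-- `𝔸^(lam)(𝔻ⁿ)` as a Hilbert module over the symmetric polynomials, under pointwise
multiplication. -/
noncomputable def bergmanModule (n : ℕ) (lam : ℝ) [Fact (0 < lam)] :
    HilbertModule (SymPoly n) (BergmanSpace n lam) where
  toFun p := mulOp p.1
  map_one' := by
    refine ContinuousLinearMap.ext fun f => RKHS.ext fun z => ?_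
    simp
  map_mul' p q := by
    refine ContinuousLinearMap.ext fun f => RKHS.ext fun z => ?_
    simp [mul_assoc]
  map_zero' := by
    refine ContinuousLinearMap.ext fun f => RKHS.ext fun z => ?_
    simp
  map_add' p q := by
    refine ContinuousLinearMap.ext fun f => RKHS.ext fun z => ?_
    simp [add_mul]
  commutes' c := by
    refine ContinuousLinearMap.ext fun f => RKHS.ext fun z => ?_
    simp [Algebra.algebraMap_eq_smul_one]

theorem bergmanModule_permOp (p : SymPoly n) (σ : Equiv.Perm (Fin n)) (f : BergmanSpace n lam) :
    bergmanModule n lam p (permOp σ f) = permOp σ (bergmanModule n lam p f) := by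
  refine RKHS.ext fun z => ?_
  change mulOp p.1 _ z = permOp σ (mulOp p.1 f) z
  rw [mulOp_apply, permOp_apply, permOp_apply, mulOp_apply]
  congr 1
  have h : rename σ p.1 = p.1 := p.2 σ
  conv_lhs => rw [← h, eval_rename]
  rfl

/-! ## Unitary matrix representations of the symmetric group and the sub-modules -/

/-- A unitary matrix representation `σ ↦ π(σ) = (π^{ij}(σ))` of `𝔖ₙ` of size `m`. -/
abbrev UnitaryRep (n m : ℕ) : Type :=
  Equiv.Perm (Fin n) →* Matrix.unitaryGroup (Fin m) ℂ

namespace UnitaryRep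

variable {m : ℕ}

/-- The matrix representation, as a linear representation on `ℂᵐ`. -/
noncomputable def toRepresentation (π : UnitaryRep n m) :
    Representation ℂ (Equiv.Perm (Fin n)) (Fin m → ℂ) :=
  ((Matrix.toLinAlgEquiv' : Matrix (Fin m) (Fin m) ℂ ≃ₐ[ℂ] _) :
      Matrix (Fin m) (Fin m) ℂ →* Module.End ℂ (Fin m → ℂ)).comp
    ((Matrix.unitaryGroup (Fin m) ℂ).subtype.comp π)

/-- The matrix representation is irreducible. The irreducible `π` are exactly the possible choices of
representatives `π_p` of the equivalence classes labelled by the partitions `p` of `n`. -/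
def IsIrreducible (π : UnitaryRep n m) : Prop := π.toRepresentation.IsIrreducible

/-- The character `χ(σ) = trace π(σ)`. -/
noncomputable def character (π : UnitaryRep n m) (σ : Equiv.Perm (Fin n)) : ℂ :=
  Matrix.trace (π σ : Matrix (Fin m) (Fin m) ℂ)

/-- `ℙ^{ij} f = (χ(1) / n!) ∑_σ π^{ji}(σ⁻¹) (f ∘ σ⁻¹)`. -/
noncomputable def projEntry (lam : ℝ) [Fact (0 < lam)] (π : UnitaryRep n m) (i j : Fin m) :
    BergmanSpace n lam →L[ℂ] BergmanSpace n lam :=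
  (π.character 1 / (n.factorial : ℂ)) •
    ∑ σ : Equiv.Perm (Fin n), (π σ⁻¹ : Matrix (Fin m) (Fin m) ℂ) j i • permOp σ

/-- `ℙ f = (χ(1) / n!) ∑_σ conj χ(σ) (f ∘ σ⁻¹)`. -/
noncomputable def proj (lam : ℝ) [Fact (0 < lam)] (π : UnitaryRep n m) :
    BergmanSpace n lam →L[ℂ] BergmanSpace n lam :=
  (π.character 1 / (n.factorial : ℂ)) •
    ∑ σ : Equiv.Perm (Fin n), conj (π.character σ) • permOp σ

theorem invariant_range (c : ℂ) (a : Equiv.Perm (Fin n) → ℂ) (p : SymPoly n) :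
    ∀ h ∈ LinearMap.range (c • ∑ σ : Equiv.Perm (Fin n), a σ • permOp σ :
        BergmanSpace n lam →L[ℂ] BergmanSpace n lam).toLinearMap,
      bergmanModule n lam p h ∈ LinearMap.range (c • ∑ σ : Equiv.Perm (Fin n), a σ • permOp σ :
        BergmanSpace n lam →L[ℂ] BergmanSpace n lam).toLinearMap := by
  rintro _ ⟨f, rfl⟩
  refine ⟨bergmanModule n lam p f, ?_⟩
  simp [bergmanModule_permOp]

/-- The subspace `ℙ^{ii}(𝔸^(lam)(𝔻ⁿ))`. -/
noncomputable def entrySpace (lam : ℝ) [Fact (0 < lam)] (π : UnitaryRep n m) (i : Fin m) :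
    Submodule ℂ (BergmanSpace n lam) :=
  LinearMap.range (π.projEntry lam i i).toLinearMap

/-- The sub-module `ℙ^{ii}(𝔸^(lam)(𝔻ⁿ))` over the symmetric polynomials. -/
noncomputable def entryModule (lam : ℝ) [Fact (0 < lam)] (π : UnitaryRep n m) (i : Fin m) :
    HilbertModule (SymPoly n) (π.entrySpace lam i) :=
  (bergmanModule n lam).restrict (π.entrySpace lam i) fun p => invariant_range _ _ p

/-- The subspace `ℙ(𝔸^(lam)(𝔻ⁿ))`. -/
noncomputable def isotypicSpace (lam : ℝ) [Fact (0 < lam)] (π : UnitaryRep n m) :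
    Submodule ℂ (BergmanSpace n lam) :=
  LinearMap.range (π.proj lam).toLinearMap

/-- The sub-module `ℙ(𝔸^(lam)(𝔻ⁿ))` over the symmetric polynomials. -/
noncomputable def isotypicModule (lam : ℝ) [Fact (0 < lam)] (π : UnitaryRep n m) :
    HilbertModule (SymPoly n) (π.isotypicSpace lam) :=
  (bergmanModule n lam).restrict (π.isotypicSpace lam) fun p => invariant_range _ _ p

end UnitaryRep

end PolydiscBergman

namespace PolydiscBergman

open Complex MvPolynomial
open scoped ComplexConjugate

/-! ## Density of the polynomials -/

/-! A unitary module map carries the joint kernel of the adjoints of `r - r(w)`, with `r` symmetric,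
onto the corresponding joint kernel, so its dimension at each point `w` is an invariant. At a point
with distinct coordinates this dimension is χ(1) for the range of `ℙ^{ii}` and χ(1)² for the range
of `ℙ`, which separates the modules in both parts.

On the whole space the joint kernel at such a `w` has as basis the n! kernel functions at the points
`w ∘ σ` (`orbitMap_injective`, `range_orbitMap`). One input is algebraic: modulo the ideal generated
by all `r - r(w)`, a polynomial is determined by its values on the orbit (`exists_interpolation`).
The other is analytic: polynomials are dense (`eq_zero_of_inner_polynomial_eq_zero`), because every
kernel function is obtained from the constant 1 by norm-convergent series of multiplications by
powers of the coordinates.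

The symmetric group permutes these kernel functions as in its regular representation. By Schur
orthogonality both projections come from self-adjoint idempotents `a` of the group algebra, and they
commute with symmetric multipliers. The joint kernel of a sub-module is therefore the image of `a`
in the regular representation, and the rank of this idempotent is its trace n!·a(1)
(`finrank_jointEigenspace_restrict`). -/

theorem binCoeff_pos {lam : ℝ} (h : 0 < lam) (m : ℕ) : 0 < binCoeff lam m :=
  div_pos (ascPochhammer_pos m lam h) (Nat.cast_pos.2 (Nat.factorial_pos m))

/-- The ratio of consecutive coefficients is (lam + m)/(m + 1) = 1 - (1 - lam)/(m + 1), which is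
nondecreasing in `m` when lam ≤ 1; hence supermultiplicativity. -/
theorem binCoeff_mul_le {lam : ℝ} (h : 0 < lam) (h1 : lam ≤ 1) (j m : ℕ) :
    binCoeff lam j * binCoeff lam m ≤ binCoeff lam (j + m) := by
  induction m with
  | zero => simp [binCoeff]
  | succ m ih =>
    have e1 := binCoeff_succ lam m
    have e2 := binCoeff_succ lam (j + m)
    push_cast at e2
    have hm : (0 : ℝ) < m + 1 := by positivity
    have hj : (0 : ℝ) < j + m + 1 := by positivity
    have e3 : binCoeff lam (m + 1) = (lam + m) * binCoeff lam m / (m + 1) := by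
      field_simp; linarith
    have e4 : binCoeff lam (j + (m + 1)) = (lam + (j + m)) * binCoeff lam (j + m) / (j + m + 1) := by
      rw [← add_assoc]; field_simp; linarith
    rw [e3, e4, mul_div_assoc', div_le_div_iff₀ hm hj]
    have h5 : 0 ≤ (j : ℝ) * (1 - lam) := mul_nonneg (Nat.cast_nonneg _) (by linarith)
    have h6 : 0 ≤ binCoeff lam (j + m) := binCoeff_nonneg h _
    calc binCoeff lam j * ((lam + m) * binCoeff lam m) * (j + m + 1)
        = (lam + m) * (j + m + 1) * (binCoeff lam j * binCoeff lam m) := by ring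
      _ ≤ (lam + m) * (j + m + 1) * binCoeff lam (j + m) := by gcongr
      _ ≤ (lam + (j + m)) * (m + 1) * binCoeff lam (j + m) := by
          have : (lam + m) * (j + m + 1) ≤ (lam + (j + m)) * (m + 1) := by nlinarith
          exact mul_le_mul_of_nonneg_right this h6
      _ = (lam + (j + m)) * binCoeff lam (j + m) * (m + 1) := by ring

theorem binCoeff_le_add {lam : ℝ} (h1 : 1 ≤ lam) (j m : ℕ) :
    binCoeff lam j ≤ binCoeff lam (j + m) := by
  induction m with
  | zero => rfl
  | succ m ih =>
    refine ih.trans ?_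
    have e2 := binCoeff_succ lam (j + m)
    have h6 : 0 ≤ binCoeff lam (j + m) := binCoeff_nonneg (by linarith) _
    have hj : (0 : ℝ) < ((j + m : ℕ) : ℝ) + 1 := by positivity
    rw [← add_assoc]
    refine le_of_mul_le_mul_left ?_ hj
    rw [e2]
    exact mul_le_mul_of_nonneg_right (by linarith) h6

/-- The constant is the sum of those for the two regimes: 1/binCoeff suffices for lam ≤ 1 by
supermultiplicativity, and 1 suffices for lam ≥ 1, where the coefficients are nondecreasing. -/
theorem binCoeff_le_mul {lam : ℝ} (h : 0 < lam) (j m : ℕ) :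
    binCoeff lam j ≤ (1 + 1 / binCoeff lam m) * binCoeff lam (j + m) := by
  have hm := binCoeff_pos h m
  have hjm := binCoeff_pos h (j + m)
  rcases le_total lam 1 with h1 | h1
  · have := binCoeff_mul_le h h1 j m
    rw [← le_div_iff₀ hm] at this
    calc _ ≤ _ := this
      _ ≤ _ := by rw [add_mul, one_div, div_eq_inv_mul]; linarith
  · have := binCoeff_le_add h1 j m
    have h3 : 0 ≤ 1 / binCoeff lam m * binCoeff lam (j + m) := by positivity
    rw [add_mul]; linarith

/-- Positivity behind the norm bound for multiplication by a power of a coordinate function. -/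
theorem isPD_sub_pow_mul_bergmanKernel {n : ℕ} {lam : ℝ} (h : 0 < lam) (i : Fin n) (m : ℕ) :
    IsPD (fun z w => ((1 + 1 / binCoeff lam m : ℝ) - ((z i : ℂ) * conj (w i : ℂ)) ^ m) *
      bergmanKernel n lam z w) := by
  classical
  set C : ℝ := 1 + 1 / binCoeff lam m with hC
  -- Taylor coefficients of (C - x^m)(1 - x)^(-lam); the case `k < m` guards against truncated
  -- subtraction in `k - m`.
  set a : ℕ → ℝ := fun k => C * binCoeff lam k - (if k < m then 0 else binCoeff lam (k - m)) with ha
  have hC0 : 0 ≤ C := by have := binCoeff_pos h m; positivity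
  have ha0 : ∀ k, 0 ≤ a k := by
    intro k
    have h2 := binCoeff_nonneg h k
    by_cases hk : k < m
    · simp only [ha, hk, if_true, sub_zero]
      positivity
    · have := binCoeff_le_mul h (k - m) m
      rw [Nat.sub_add_cancel (not_lt.1 hk)] at this
      simpa only [ha, hk, if_false, sub_nonneg] using this
  have hs : ∀ z w : Polydisc n, HasSum
      (fun k => (a k : ℂ) * ((z i : ℂ) * conj (w i : ℂ)) ^ k)
      (((C : ℂ) - ((z i : ℂ) * conj (w i : ℂ)) ^ m) *
        (1 - (z i : ℂ) * conj (w i : ℂ)) ^ (-(lam : ℂ))) := by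
    intro z w
    set x : ℂ := (z i : ℂ) * conj (w i : ℂ) with hx
    have h1 := hasSum_binCoeff lam (norm_mul_conj_lt_one (z i) (w i))
    rw [← hx] at h1
    have h2 : HasSum (fun k : ℕ => ((if k < m then 0 else binCoeff lam (k - m) : ℝ) : ℂ) * x ^ k)
        (x ^ m * (1 - x) ^ (-(lam : ℂ))) := by
      rw [← hasSum_nat_add_iff' m, Finset.sum_eq_zero, sub_zero]
      · have e : (fun k => ((if k + m < m then 0 else binCoeff lam (k + m - m) : ℝ) : ℂ)
            * x ^ (k + m)) = fun k => x ^ m * ((binCoeff lam k : ℂ) * x ^ k) := by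
          ext k
          rw [if_neg (by omega), Nat.add_sub_cancel, pow_add]; ring
        rw [e]
        exact h1.mul_left _
      · intro k hk
        rw [if_pos (Finset.mem_range.1 hk)]; simp
    have e : (fun k => (a k : ℂ) * x ^ k) = fun k => (C : ℂ) * ((binCoeff lam k : ℂ) * x ^ k)
        - ((if k < m then 0 else binCoeff lam (k - m) : ℝ) : ℂ) * x ^ k := by
      ext k; simp only [ha]; rw [ofReal_sub, ofReal_mul]; ring
    rw [e, sub_mul]
    exact (h1.mul_left (C : ℂ)).sub h2
  have := (isPD_finsetProd h (Finset.univ.erase i)).mul_series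
    (fun z : Polydisc n => (z i : ℂ)) ha0 hs
  convert this using 3 with z w
  rw [bergmanKernel, ← Finset.mul_prod_erase _ _ (Finset.mem_univ i), mul_assoc]

theorem inner_kerFun_one {X H : Type*} [NormedAddCommGroup H]
    [InnerProductSpace ℂ H] [CompleteSpace H] [RKHS ℂ H X ℂ] (x : X) (f : H) :
    inner ℂ (RKHS.kerFun H x 1) f = f x := by
  rw [RKHS.kerFun_inner]; simp

theorem denseRange_linearCombination_kerFun {X H : Type*} [NormedAddCommGroup H]
    [InnerProductSpace ℂ H] [CompleteSpace H] [RKHS ℂ H X ℂ] :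
    DenseRange (Finsupp.linearCombination ℂ (fun x : X => RKHS.kerFun H x (1 : ℂ))) := by
  have h1 := RKHS.kerFun_dense (𝕜 := ℂ) H
  rw [DenseRange, ← LinearMap.coe_range, Submodule.dense_iff_topologicalClosure_eq_top,
    eq_top_iff, ← h1]
  refine Submodule.topologicalClosure_mono (Submodule.span_le.2 ?_)
  rintro _ ⟨x, v, rfl⟩
  refine ⟨Finsupp.single x v, ?_⟩
  rw [Finsupp.linearCombination_single, ← map_smul, smul_eq_mul, mul_one]

/-- The norm of a multiplication operator on a reproducing kernel Hilbert space is controlled by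
the positivity of `(C - u x * conj (u y)) * k x y`. -/
theorem norm_le_sqrt_of_isPD {X H : Type*} [NormedAddCommGroup H]
    [InnerProductSpace ℂ H] [CompleteSpace H] [RKHS ℂ H X ℂ] (u : X → ℂ) {C : ℝ}
    (hC : 0 ≤ C)
    (hpd : IsPD fun x y => ((C : ℂ) - u x * conj (u y)) * RKHS.kernel H x y 1)
    (M : H →L[ℂ] H) (hM : ∀ f x, M f x = u x * f x) : ‖M‖ ≤ √C := by
  have hT : ∀ x, M.adjoint (RKHS.kerFun H x 1) = conj (u x) • RKHS.kerFun H x 1 := by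
    intro x
    refine ext_inner_right ℂ fun f => ?_
    rw [ContinuousLinearMap.adjoint_inner_left, inner_kerFun_one, hM, inner_smul_left,
      inner_kerFun_one, conj_conj]
  set e := Finsupp.linearCombination ℂ (fun x : X => RKHS.kerFun H x (1 : ℂ)) with he
  have hbound : ∀ c, ‖M.adjoint (e c)‖ ≤ √C * ‖e c‖ := by
    intro c
    have hMc : M.adjoint (e c) =
        Finsupp.linearCombination ℂ (fun x => conj (u x) • RKHS.kerFun H x (1 : ℂ)) c := by
      simp [he, Finsupp.linearCombination_apply, Finsupp.sum, hT]
    have h1 := inner_linearCombination_kerFun (H := H) (fun x => conj (u x)) (fun x : X => x) c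
    have h2 := inner_linearCombination_kerFun (H := H) (fun _ => 1) (fun x : X => x) c
    simp only [one_smul] at h2
    have h3 := hpd c
    rw [← hMc] at h1
    have h4 : (∑ x ∈ c.support, ∑ y ∈ c.support, conj (c x) * c y *
        (((C : ℂ) - u x * conj (u y)) * RKHS.kernel H x y 1))
        = ((C * ‖e c‖ ^ 2 - ‖M.adjoint (e c)‖ ^ 2 : ℝ) : ℂ) := by
      rw [ofReal_sub, ofReal_mul, h1, h2, Finset.mul_sum, ← Finset.sum_sub_distrib]
      refine Finset.sum_congr rfl fun x _ => ?_
      rw [Finset.mul_sum, ← Finset.sum_sub_distrib]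
      refine Finset.sum_congr rfl fun y _ => ?_
      simp
      ring
    rw [h4, ofReal_re] at h3
    refine abs_le_of_sq_le_sq' ?_ (by positivity) |>.2
    rw [mul_pow, Real.sq_sqrt hC]
    linarith
  rw [← LinearIsometryEquiv.norm_map ContinuousLinearMap.adjoint M]
  refine ContinuousLinearMap.opNorm_le_bound _ (by positivity) fun f => ?_
  refine denseRange_linearCombination_kerFun.induction_on
    (p := fun f => ‖M.adjoint f‖ ≤ √C * ‖f‖) f ?_ hbound
  exact isClosed_le (by fun_prop) (by fun_prop)

variable {n : ℕ} {lam : ℝ} [Fact (0 < lam)]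

/-- Iterating the bound for a single coordinate would give exponential growth in `m`. This bound is
weak enough to hold for every lam > 0, yet leaves the series of the next lemma convergent on the
whole disc. -/
theorem norm_mulOp_X_pow_le (i : Fin n) (m : ℕ) :
    ‖(mulOp (X i ^ m) : BergmanSpace n lam →L[ℂ] BergmanSpace n lam)‖ ≤
      √(1 + 1 / binCoeff lam m) := by
  have hlam : 0 < lam := Fact.out
  have := binCoeff_pos hlam m
  refine norm_le_sqrt_of_isPD (fun z : Polydisc n => (z i : ℂ) ^ m) (by positivity) ?_ _
    fun f z => by simp
  have := isPD_sub_pow_mul_bergmanKernel (n := n) hlam i m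
  simpa only [kernel_bergmanSpace, mul_one, map_pow, ← mul_pow] using this

theorem summable_binCoeff_smul_mulOp (i : Fin n) {c : ℂ} (hc : ‖c‖ < 1) (f : BergmanSpace n lam) :
    Summable fun m : ℕ => ((binCoeff lam m : ℂ) * c ^ m) • mulOp (X i ^ m) f := by
  have hlam : 0 < lam := Fact.out
  have hs1 : Summable fun m : ℕ => binCoeff lam m * ‖c‖ ^ m := by
    have h := (hasSum_binCoeff lam (x := (‖c‖ : ℂ)) (by simpa using hc)).summable
    have := Complex.reCLM.summable h
    refine this.congr fun m => ?_
    rw [Complex.reCLM_apply, ← ofReal_pow, ← ofReal_mul, ofReal_re]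
  have hs2 : Summable fun m : ℕ => (binCoeff lam m * ‖c‖ ^ m + ‖c‖ ^ m) * ‖f‖ :=
    (hs1.add (summable_geometric_of_lt_one (norm_nonneg _) hc)).mul_right _
  refine Summable.of_norm_bounded hs2 fun m => ?_
  have ha := binCoeff_pos hlam m
  rw [norm_smul, norm_mul, norm_pow, Complex.norm_of_nonneg ha.le]
  have h1 : ‖mulOp (X i ^ m) f‖ ≤ √(1 + 1 / binCoeff lam m) * ‖f‖ :=
    (ContinuousLinearMap.le_opNorm _ _).trans (by gcongr; exact norm_mulOp_X_pow_le i m)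
  -- Writing b for the coefficient, the left side is √(b² + b), so the series is dominated by a
  -- binomial series plus a geometric one.
  have h2 : binCoeff lam m * √(1 + 1 / binCoeff lam m) ≤ binCoeff lam m + 1 := by
    refine abs_le_of_sq_le_sq' ?_ (by positivity) |>.2
    rw [mul_pow, Real.sq_sqrt (by positivity)]
    field_simp
    nlinarith
  calc binCoeff lam m * ‖c‖ ^ m * ‖mulOp (X i ^ m) f‖
      ≤ binCoeff lam m * ‖c‖ ^ m * (√(1 + 1 / binCoeff lam m) * ‖f‖) := by gcongr
    _ = (binCoeff lam m * √(1 + 1 / binCoeff lam m)) * (‖c‖ ^ m * ‖f‖) := by ring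
    _ ≤ (binCoeff lam m + 1) * (‖c‖ ^ m * ‖f‖) := by gcongr
    _ = _ := by ring

theorem mulOp_mul_apply (p q : MvPolynomial (Fin n) ℂ) (f : BergmanSpace n lam) :
    mulOp (p * q) f = mulOp p (mulOp q f) :=
  RKHS.ext fun z => by simp [mul_assoc]

/-- The constant function `1`, as an element of the weighted Bergman space. -/
noncomputable def constOne (n : ℕ) (lam : ℝ) [Fact (0 < lam)] : BergmanSpace n lam :=
  RKHS.kerFun (BergmanSpace n lam) (fun _ => 0 : Polydisc n) 1

@[simp]
theorem constOne_apply (z : Polydisc n) : constOne n lam z = 1 := by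
  rw [constOne, RKHS.kerFun_apply, kernel_bergmanSpace]
  simp [bergmanKernel]

/-- Expanding (1 - z_i c̄)^(-lam) gives a norm-convergent series of polynomial multiples of `f`, all
orthogonal to `g`. Orthogonality to every polynomial multiple, rather than to `f` alone, is what
lets the construction be repeated in the next coordinate. -/
theorem exists_mul_cpow_orthogonal {g : BergmanSpace n lam} (i : Fin n) (c : UnitDisc)
    {f : BergmanSpace n lam} (hf : ∀ p, inner ℂ g (mulOp p f) = 0) :
    ∃ f' : BergmanSpace n lam, (∀ p, inner ℂ g (mulOp p f') = 0) ∧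
      ∀ z, f' z = (1 - (z i : ℂ) * conj (c : ℂ)) ^ (-(lam : ℂ)) * f z := by
  have hc : ‖conj (c : ℂ)‖ < 1 := by rw [norm_conj]; exact c.norm_lt_one
  have hs := (summable_binCoeff_smul_mulOp i hc f).hasSum
  refine ⟨∑' m : ℕ, ((binCoeff lam m : ℂ) * conj (c : ℂ) ^ m) • mulOp (X i ^ m) f,
    fun p => ?_, fun z => ?_⟩
  · have h1 := ((innerSL ℂ g).comp (mulOp p)).hasSum hs
    refine h1.unique ?_
    convert hasSum_zero with m
    simp only [ContinuousLinearMap.comp_apply, map_smul, innerSL_apply_apply]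
    rw [← mulOp_mul_apply, hf, smul_zero]
  · have h1 := (innerSL ℂ (RKHS.kerFun (BergmanSpace n lam) z 1)).hasSum hs
    simp only [innerSL_apply_apply, inner_kerFun_one] at h1
    refine h1.unique ?_
    refine ((hasSum_binCoeff lam (norm_mul_conj_lt_one (z i) c)).mul_right (f z)).congr_fun ?_
    intro m
    rw [RKHS.coe_smul, Pi.smul_apply, mulOp_apply, smul_eq_mul]
    simp only [map_pow, eval_X]
    ring

/-- The polynomials are dense in the weighted Bergman space. -/
theorem eq_zero_of_inner_polynomial_eq_zero {g : BergmanSpace n lam}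
    (hg : ∀ p, inner ℂ g (mulOp p (constOne n lam)) = 0) : g = 0 := by
  classical
  -- Coordinate by coordinate, the constant 1 is turned into the kernel function at `w`, staying
  -- orthogonal to `g`; the reproducing property then gives g(w) = 0.
  have key : ∀ (w : Polydisc n) (s : Finset (Fin n)), ∃ f : BergmanSpace n lam,
      (∀ p, inner ℂ g (mulOp p f) = 0) ∧
      ∀ z, f z = ∏ j ∈ s, (1 - (z j : ℂ) * conj (w j : ℂ)) ^ (-(lam : ℂ)) := by
    intro w s
    induction s using Finset.induction_on with
    | empty => exact ⟨_, hg, fun z => by simp⟩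
    | insert j s hj ih =>
      obtain ⟨f, hf, hf'⟩ := ih
      obtain ⟨f₁, h1, h2⟩ := exists_mul_cpow_orthogonal j (w j) hf
      exact ⟨f₁, h1, fun z => by rw [h2, hf', Finset.prod_insert hj]⟩
  refine RKHS.ext fun w => ?_
  obtain ⟨f, hf, hf'⟩ := key w Finset.univ
  have e1 : mulOp 1 f = RKHS.kerFun (BergmanSpace n lam) w 1 := by
    refine RKHS.ext fun z => ?_
    rw [mulOp_apply, RKHS.kerFun_apply, kernel_bergmanSpace, hf', bergmanKernel]
    simp
  have := hf 1
  rw [e1, ← inner_conj_symm, inner_kerFun_one, map_eq_zero] at this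
  simpa using this

end PolydiscBergman

namespace PolydiscBergman

open Complex MvPolynomial
open scoped ComplexConjugate

/-! ## Interpolation on a free orbit of the symmetric group -/

/-- The ideal generated by the symmetric polynomials vanishing at `w`. -/
noncomputable def orbitIdeal {n : ℕ} (w : Fin n → ℂ) : Ideal (MvPolynomial (Fin n) ℂ) :=
  Ideal.span {p | ∃ r : SymPoly n, p = r.1 - C (eval w r.1)}

variable {n : ℕ} {w : Fin n → ℂ}

theorem mk_eq_of_isSymmetric {r : MvPolynomial (Fin n) ℂ} (hr : r.IsSymmetric) :
    Ideal.Quotient.mk (orbitIdeal w) r = algebraMap ℂ _ (eval w r) := by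
  rw [IsScalarTower.algebraMap_apply ℂ (MvPolynomial (Fin n) ℂ), Ideal.Quotient.algebraMap_eq,
    Ideal.Quotient.mk_eq_mk_iff_sub_mem]
  exact Ideal.subset_span ⟨⟨r, hr⟩, rfl⟩

theorem isSymmetric_prod_C_sub_X (t : ℂ) :
    (∏ j : Fin n, (C t - X j : MvPolynomial (Fin n) ℂ)).IsSymmetric := by
  intro σ
  rw [map_prod]
  simp only [map_sub, rename_C, rename_X]
  exact Equiv.prod_comp σ (fun j => (C t - X j : MvPolynomial (Fin n) ℂ))

/-- The coefficients of ∏ (T - X_j) are symmetric, so in the quotient they equal their values at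
`w`. Substituting T = X_i kills the product, so X_i is a root of the polynomial with roots w_j. -/
theorem aeval_nodal_eq_zero (i : Fin n) :
    Polynomial.aeval (Ideal.Quotient.mk (orbitIdeal w) (X i))
      (Lagrange.nodal Finset.univ w) = 0 := by
  set R := MvPolynomial (Fin n) ℂ ⧸ orbitIdeal w
  have h : (∏ j, (Polynomial.X - Polynomial.C (Ideal.Quotient.mk (orbitIdeal w) (X j))) :
      Polynomial R) = (Lagrange.nodal Finset.univ w).map (algebraMap ℂ R) := by
    set Q : Polynomial (MvPolynomial (Fin n) ℂ) :=
      ∏ j, (Polynomial.X - Polynomial.C (X j)) with hQ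
    have hsymm : ∀ k, (Q.coeff k).IsSymmetric := by
      intro k σ
      have : Q.map (rename σ : MvPolynomial (Fin n) ℂ →ₐ[ℂ] _).toRingHom = Q := by
        simp only [hQ, Polynomial.map_prod, Polynomial.map_sub, Polynomial.map_X, Polynomial.map_C,
          AlgHom.toRingHom_eq_coe, RingHom.coe_coe, rename_X]
        exact Equiv.prod_comp σ (fun j => (Polynomial.X - Polynomial.C (X j) :
          Polynomial (MvPolynomial (Fin n) ℂ)))
      conv_rhs => rw [← this]
      rw [Polynomial.coeff_map]
      rfl
    have h1 : Q.map (Ideal.Quotient.mk (orbitIdeal w)) =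
        (Q.map (eval w)).map (algebraMap ℂ R) := by
      ext k
      simp only [Polynomial.coeff_map]
      exact mk_eq_of_isSymmetric (hsymm k)
    simpa [hQ, Polynomial.map_prod, Lagrange.nodal_eq] using h1
  have h2 := congrArg (Polynomial.eval (Ideal.Quotient.mk (orbitIdeal w) (X i))) h
  rw [Polynomial.eval_prod, Finset.prod_eq_zero (Finset.mem_univ i) (by simp),
    Polynomial.eval_map_algebraMap] at h2
  exact h2.symm

/-- Modulo the symmetric polynomials vanishing at a point `w` with distinct coordinates, every
polynomial is determined by its values on the orbit of `w`. -/
theorem exists_interpolation (hw : Function.Injective w) :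
    ∃ E : Equiv.Perm (Fin n) → MvPolynomial (Fin n) ℂ,
      (∀ σ τ : Equiv.Perm (Fin n), eval (w ∘ τ) (E σ) = if σ = τ then 1 else 0) ∧
      ∀ f, f - ∑ σ : Equiv.Perm (Fin n), C (eval (w ∘ σ) f) * E σ ∈ orbitIdeal w := by
  classical
  set mk := Ideal.Quotient.mk (orbitIdeal w) with hmk
  -- Tensor products of Lagrange polynomials are indexed by all self-maps, so that they sum to 1;
  -- the non-bijective ones are shown to vanish in the quotient.
  set E : (Fin n → Fin n) → MvPolynomial (Fin n) ℂ :=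
    fun τ => ∏ i, Polynomial.aeval (X i) (Lagrange.basis Finset.univ w (τ i)) with hE
  have hsum : ∑ τ, E τ = 1 := by
    rw [hE, ← Fintype.piFinset_univ, ← Finset.prod_univ_sum (fun _ => Finset.univ)
      (fun i j => Polynomial.aeval (X i : MvPolynomial (Fin n) ℂ) (Lagrange.basis Finset.univ w j))]
    refine Finset.prod_eq_one fun i _ => ?_
    rw [← map_sum, Lagrange.sum_basis hw.injOn ⟨i, Finset.mem_univ i⟩, map_one]
  have hX : ∀ i j, mk (Polynomial.aeval (X i) (Lagrange.basis Finset.univ w j)) * mk (X i) =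
      mk (Polynomial.aeval (X i) (Lagrange.basis Finset.univ w j)) * mk (C (w j)) := by
    intro i j
    have h1 := aeval_nodal_eq_zero (w := w) i
    have h2 : Lagrange.basis Finset.univ w j * (Polynomial.X - Polynomial.C (w j)) =
        Polynomial.C (Lagrange.nodalWeight Finset.univ w j) * Lagrange.nodal Finset.univ w := by
      rw [Lagrange.basis_eq_prod_sub_inv_mul_nodal_div (Finset.mem_univ j),
        ← Lagrange.nodal_erase_eq_nodal_div (Finset.mem_univ j),
        Lagrange.nodal_eq_mul_nodal_erase (Finset.mem_univ j)]
      ring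
    have h3 : ∀ u : Polynomial ℂ, mk (Polynomial.aeval (X i) u) =
        Polynomial.aeval (mk (X i)) u := fun u =>
      (Polynomial.aeval_algHom_apply (Ideal.Quotient.mkₐ ℂ (orbitIdeal w)) (X i) u).symm
    have h4 := congrArg (fun u => mk (Polynomial.aeval (X i) u)) h2
    simp only [map_mul, map_sub, Polynomial.aeval_X, Polynomial.aeval_C, algebraMap_eq] at h4
    rw [h3 (Lagrange.nodal _ _), h1, mul_zero, mul_sub, sub_eq_zero] at h4
    exact h4
  -- In the quotient each `E τ` is a joint eigenvector of multiplication, with eigencharacter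
  -- evaluation at `w ∘ τ`.
  have hmul : ∀ f τ, mk (f * E τ) = mk (C (eval (w ∘ τ) f) * E τ) := by
    intro f τ
    induction f using MvPolynomial.induction_on with
    | C a => simp
    | add p q hp hq => rw [add_mul, map_add, hp, hq, ← map_add, ← add_mul, ← map_add, ← map_add]
    | mul_X p i hp =>
      have : mk (E τ) * mk (X i) = mk (E τ) * mk (C (w (τ i))) := by
        simp only [hE]
        rw [← Finset.mul_prod_erase _ _ (Finset.mem_univ i), map_mul]
        linear_combination (mk (∏ k ∈ Finset.univ.erase i,
          Polynomial.aeval (X k) (Lagrange.basis Finset.univ w (τ k)))) * hX i (τ i)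
      simp only [map_mul, eval_X, Function.comp_apply] at hp ⊢
      linear_combination mk (X i) * hp + mk (C (eval (w ∘ τ) p)) * this
  -- If `τ` misses `j`, the symmetric polynomial ∏ (w_j - X_k) acts on `E τ` both by its value at
  -- `w`, which is 0, and by its value at `w ∘ τ`, which is nonzero.
  have hzero : ∀ τ, ¬ Function.Injective τ → mk (E τ) = 0 := by
    intro τ hτ
    rw [Finite.injective_iff_surjective, Function.Surjective] at hτ
    push Not at hτ
    obtain ⟨j, hj⟩ := hτ
    have h1 := hmul (∏ k, (C (w j) - X k)) τ
    rw [map_mul, mk_eq_of_isSymmetric (isSymmetric_prod_C_sub_X _)] at h1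
    have h2 : eval w (∏ k, (C (w j) - X k)) = 0 := by
      rw [map_prod]; exact Finset.prod_eq_zero (Finset.mem_univ j) (by simp)
    have h3 : eval (w ∘ τ) (∏ k, (C (w j) - X k)) ≠ 0 := by
      rw [map_prod]
      refine Finset.prod_ne_zero_iff.2 fun k _ => ?_
      simp only [map_sub, eval_C, eval_X, Function.comp_apply, sub_ne_zero]
      exact fun h => hj k (hw h).symm
    rw [h2, map_zero, zero_mul] at h1
    have h4 : E τ = C (eval (w ∘ τ) (∏ k, (C (w j) - X k)))⁻¹ *
        (C (eval (w ∘ τ) (∏ k, (C (w j) - X k))) * E τ) := by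
      rw [← mul_assoc, ← C_mul, inv_mul_cancel₀ h3, C_1, one_mul]
    rw [h4, map_mul, ← h1, mul_zero]
  refine ⟨fun σ => E σ, fun σ τ => ?_, fun f => ?_⟩
  · rw [hE, map_prod]
    have e : ∀ i, eval (w ∘ τ) (Polynomial.aeval (X i) (Lagrange.basis Finset.univ w (σ i)))
        = if σ i = τ i then 1 else 0 := by
      intro i
      have : eval (w ∘ τ) (Polynomial.aeval (X i) (Lagrange.basis Finset.univ w (σ i)))
          = Polynomial.eval (w (τ i)) (Lagrange.basis Finset.univ w (σ i)) := by
        rw [← MvPolynomial.coe_aeval_eq_eval, RingHom.coe_coe, ← Polynomial.aeval_algHom_apply]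
        simp
      rw [this]
      split_ifs with h
      · rw [← h, Lagrange.eval_basis_self hw.injOn (Finset.mem_univ _)]
      · rw [Lagrange.eval_basis_of_ne h (Finset.mem_univ _)]
    simp only [e]
    rw [Finset.prod_ite_zero]
    simp [Equiv.ext_iff]
  · rw [← Ideal.Quotient.mk_eq_mk_iff_sub_mem]
    calc mk f = mk (f * ∑ τ, E τ) := by rw [hsum, mul_one]
      _ = ∑ τ, mk (C (eval (w ∘ τ) f) * E τ) := by
          rw [Finset.mul_sum, map_sum]; exact Finset.sum_congr rfl fun τ _ => hmul f τ
      _ = ∑ σ : Equiv.Perm (Fin n), mk (C (eval (w ∘ σ) f) * E σ) := by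
          refine (Fintype.sum_of_injective (fun σ : Equiv.Perm (Fin n) => (σ : Fin n → Fin n))
            DFunLike.coe_injective _ _ (fun τ hτ => ?_) fun _ => rfl).symm
          rw [map_mul, hzero, mul_zero]
          intro hi
          exact hτ ⟨Equiv.ofBijective τ (Finite.injective_iff_bijective.1 hi), rfl⟩
      _ = _ := by rw [map_sum]

end PolydiscBergman

namespace PolydiscBergman

open Complex MvPolynomial
open scoped ComplexConjugate

/-! ## Schur orthogonality and the projections -/

namespace UnitaryRep

variable {n m : ℕ} (π : UnitaryRep n m)

theorem character_one : π.character 1 = m := by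
  simp [character]

theorem conj_apply (σ : Equiv.Perm (Fin n)) (i j : Fin m) :
    conj ((π σ : Matrix (Fin m) (Fin m) ℂ) i j) = (π σ⁻¹ : Matrix (Fin m) (Fin m) ℂ) j i := by
  rw [map_inv]
  rfl

theorem apply_mul (σ τ : Equiv.Perm (Fin n)) :
    (π (σ * τ) : Matrix (Fin m) (Fin m) ℂ) = π σ * π τ := by
  rw [map_mul]; rfl

theorem IsIrreducible.pos {π : UnitaryRep n m} (h : π.IsIrreducible) : 0 < m := by
  rcases Nat.eq_zero_or_pos m with rfl | hm
  · have : Representation.IsIrreducible π.toRepresentation := h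
    obtain ⟨a, b, hab⟩ := (inferInstance : Nontrivial (Subrepresentation π.toRepresentation))
    refine absurd (Subrepresentation.toSubmodule_injective (Subsingleton.elim _ _)) hab
  · exact hm

/-- Schur's lemma for matrices commuting with an irreducible representation. -/
theorem IsIrreducible.eq_smul_one {π : UnitaryRep n m} (h : π.IsIrreducible)
    {B : Matrix (Fin m) (Fin m) ℂ} (hB : ∀ σ, (π σ : Matrix (Fin m) (Fin m) ℂ) * B = B * π σ) :
    ∃ c : ℂ, B = c • 1 := by
  have : Representation.IsIrreducible π.toRepresentation := h
  let f : Representation.IntertwiningMap π.toRepresentation π.toRepresentation :=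
    ⟨Matrix.toLin' B, fun σ => by
      simp only [toRepresentation]
      change Matrix.toLin' B ∘ₗ Matrix.toLin' _ = Matrix.toLin' _ ∘ₗ Matrix.toLin' B
      rw [← Matrix.toLin'_mul, ← Matrix.toLin'_mul]
      exact congrArg _ (hB σ).symm⟩
  obtain ⟨c, hc⟩ :=
    (Representation.IsIrreducible.algebraMap_intertwiningMap_bijective_of_isAlgClosed
      (ρ := π.toRepresentation)).2 f
  refine ⟨c, Matrix.toLin'.injective ?_⟩
  have := congrArg Representation.IntertwiningMap.toLinearMap hc
  rw [map_smul, Matrix.toLin'_one]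
  exact this.symm

/-- Schur orthogonality for the matrix entries of an irreducible representation. -/
theorem IsIrreducible.sum_mul_apply {π : UnitaryRep n m} (h : π.IsIrreducible) (k j i l : Fin m) :
    ∑ σ, (π σ : Matrix (Fin m) (Fin m) ℂ) k j * (π σ⁻¹ : Matrix (Fin m) (Fin m) ℂ) i l =
      if j = i ∧ k = l then (n.factorial : ℂ) / m else 0 := by
  have hm : (m : ℂ) ≠ 0 := Nat.cast_ne_zero.2 h.pos.ne'
  -- Averaging a matrix unit over the group gives a matrix commuting with the representation, hence
  -- a scalar, and the trace determines that scalar.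
  set B : Matrix (Fin m) (Fin m) ℂ :=
    ∑ σ, (π σ : Matrix (Fin m) (Fin m) ℂ) * Matrix.single j i 1 * (π σ⁻¹ : Matrix _ _ ℂ) with hB
  have hentry : ∀ a b, B a b = ∑ σ, (π σ : Matrix (Fin m) (Fin m) ℂ) a j *
      (π σ⁻¹ : Matrix (Fin m) (Fin m) ℂ) i b := by
    intro a b
    rw [hB, Matrix.sum_apply]
    refine Finset.sum_congr rfl fun σ _ => ?_
    simp [Matrix.mul_apply, Matrix.single_apply, ite_and]
  obtain ⟨c, hc⟩ := h.eq_smul_one (B := B) (fun τ => by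
    rw [hB, Finset.mul_sum, Finset.sum_mul]
    refine Fintype.sum_equiv (Equiv.mulLeft τ) _ _ fun σ => ?_
    have h1 : (π (τ * σ)⁻¹ : Matrix (Fin m) (Fin m) ℂ) * π τ = π σ⁻¹ := by
      rw [← apply_mul]; congr 2; group
    rw [Equiv.coe_mulLeft, mul_assoc _ _ (π τ : Matrix (Fin m) (Fin m) ℂ), h1, apply_mul]
    simp only [mul_assoc])
  have htr : Matrix.trace B = n.factorial * if j = i then 1 else 0 := by
    have : ∀ σ, Matrix.trace ((π σ : Matrix (Fin m) (Fin m) ℂ) * Matrix.single j i 1 *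
        (π σ⁻¹ : Matrix _ _ ℂ)) = if j = i then 1 else 0 := by
      intro σ
      rw [Matrix.trace_mul_comm, ← mul_assoc, ← apply_mul]
      simp [Matrix.trace, Matrix.single_apply, ite_and, eq_comm]
    rw [hB, Matrix.trace_sum, Finset.sum_congr rfl fun σ _ => this σ]
    simp [Fintype.card_perm]
  have hc' : c = (n.factorial * if j = i then 1 else 0) / m := by
    rw [← htr, hc]
    simp [hm]
  rw [← hentry, hc, hc']
  by_cases h1 : j = i <;> by_cases h2 : k = l <;> simp [h1, h2]

end UnitaryRep

variable {n : ℕ} {lam : ℝ} [Fact (0 < lam)]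

/-! ### The group algebra acting on the Bergman space -/

theorem permOp_mul_apply (σ τ : Equiv.Perm (Fin n)) (f : BergmanSpace n lam) :
    permOp (σ * τ) f = permOp σ (permOp τ f) :=
  RKHS.ext fun z => by simp [Function.comp_assoc]

theorem permOp_kerFun (σ : Equiv.Perm (Fin n)) (w : Polydisc n) :
    permOp σ (RKHS.kerFun (BergmanSpace n lam) w 1) =
      RKHS.kerFun (BergmanSpace n lam) (w ∘ ⇑σ⁻¹) 1 := by
  refine RKHS.ext fun z => ?_
  rw [permOp_apply, RKHS.kerFun_apply, RKHS.kerFun_apply, kernel_bergmanSpace, kernel_bergmanSpace,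
    bergmanKernel, bergmanKernel]
  congr 1
  refine Fintype.prod_equiv σ _ _ fun j => ?_
  simp

/-- The kernel is invariant under simultaneous permutation of both arguments, so the operators
`permOp` form a unitary representation. -/
theorem inner_permOp_left (σ : Equiv.Perm (Fin n)) (f g : BergmanSpace n lam) :
    inner ℂ (permOp σ f) g = inner ℂ f (permOp σ⁻¹ g) := by
  have : (permOp σ : BergmanSpace n lam →L[ℂ] _).adjoint g = permOp σ⁻¹ g := by
    refine RKHS.ext fun w => ?_
    rw [← inner_kerFun_one, ContinuousLinearMap.adjoint_inner_right, permOp_kerFun,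
      inner_kerFun_one, permOp_apply]
  rw [← this, ContinuousLinearMap.adjoint_inner_right]

/-- The operator `∑ σ, a σ • R_σ` attached to an element `a` of the group algebra. -/
noncomputable def groupOp (lam : ℝ) [Fact (0 < lam)] (a : Equiv.Perm (Fin n) → ℂ) :
    BergmanSpace n lam →L[ℂ] BergmanSpace n lam :=
  ∑ σ, a σ • permOp σ

theorem groupOp_apply (a : Equiv.Perm (Fin n) → ℂ) (f : BergmanSpace n lam) :
    groupOp lam a f = ∑ σ, a σ • permOp σ f := by
  simp [groupOp]

theorem groupOp_comp (a b : Equiv.Perm (Fin n) → ℂ) (f : BergmanSpace n lam) :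
    groupOp lam a (groupOp lam b f) =
      groupOp lam (fun ρ => ∑ σ, a σ * b (σ⁻¹ * ρ)) f := by
  simp only [groupOp_apply, map_sum, map_smul, Finset.smul_sum, Finset.sum_smul]
  rw [Finset.sum_comm, Finset.sum_comm (s := Finset.univ) (t := Finset.univ) (f := fun ρ σ =>
    (a σ * b (σ⁻¹ * ρ)) • permOp ρ f)]
  refine Finset.sum_congr rfl fun σ _ => ?_
  refine Fintype.sum_equiv (Equiv.mulLeft σ) _ _ fun τ => ?_
  simp [permOp_mul_apply, mul_smul, smul_comm (a σ)]

theorem inner_groupOp_left {a : Equiv.Perm (Fin n) → ℂ} (ha : ∀ σ, conj (a σ) = a σ⁻¹)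
    (f g : BergmanSpace n lam) : inner ℂ (groupOp lam a f) g = inner ℂ f (groupOp lam a g) := by
  simp only [groupOp_apply, sum_inner, inner_sum, inner_smul_left, inner_smul_right,
    inner_permOp_left, ha]
  exact Fintype.sum_equiv (Equiv.inv _) _ _ fun σ => by simp

theorem bergmanModule_groupOp (r : SymPoly n) (a : Equiv.Perm (Fin n) → ℂ)
    (f : BergmanSpace n lam) :
    bergmanModule n lam r (groupOp lam a f) = groupOp lam a (bergmanModule n lam r f) := by
  simp [groupOp_apply, bergmanModule_permOp]

/-- A self-adjoint idempotent of the group algebra of the symmetric group. -/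
structure IsSelfAdjointIdempotent (a : Equiv.Perm (Fin n) → ℂ) : Prop where
  conj_apply : ∀ σ, conj (a σ) = a σ⁻¹
  sum_mul : ∀ ρ, ∑ σ, a σ * a (σ⁻¹ * ρ) = a ρ

namespace UnitaryRep

variable {m : ℕ}

theorem projEntry_eq_groupOp (π : UnitaryRep n m) (i j : Fin m) :
    π.projEntry lam i j = groupOp lam (fun σ => (m / n.factorial : ℂ) *
      (π σ⁻¹ : Matrix (Fin m) (Fin m) ℂ) j i) := by
  rw [projEntry, groupOp, Finset.smul_sum, character_one]
  simp only [mul_smul]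

theorem proj_eq_groupOp (π : UnitaryRep n m) :
    π.proj lam = groupOp lam (fun σ => ∑ i, (m / n.factorial : ℂ) *
      (π σ⁻¹ : Matrix (Fin m) (Fin m) ℂ) i i) := by
  rw [proj, groupOp, Finset.smul_sum, character_one]
  refine Finset.sum_congr rfl fun σ _ => ?_
  rw [← Finset.mul_sum, mul_smul]
  congr 2
  simp only [character, Matrix.trace, Matrix.diag_apply, map_sum, conj_apply]

/-- Schur orthogonality makes the diagonal entries pairwise orthogonal idempotents for convolution,
so that their sum, which gives `proj`, is idempotent too. -/
theorem IsIrreducible.sum_entry_mul {π : UnitaryRep n m} (h : π.IsIrreducible) (i j : Fin m)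
    (ρ : Equiv.Perm (Fin n)) :
    ∑ σ, ((m / n.factorial : ℂ) * (π σ⁻¹ : Matrix (Fin m) (Fin m) ℂ) i i) *
      ((m / n.factorial : ℂ) * (π (σ⁻¹ * ρ)⁻¹ : Matrix (Fin m) (Fin m) ℂ) j j) =
    if i = j then (m / n.factorial : ℂ) * (π ρ⁻¹ : Matrix (Fin m) (Fin m) ℂ) i i else 0 := by
  have hm : (m : ℂ) ≠ 0 := Nat.cast_ne_zero.2 h.pos.ne'
  have hn : (n.factorial : ℂ) ≠ 0 := Nat.cast_ne_zero.2 n.factorial_ne_zero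
  have : ∀ σ, ((m / n.factorial : ℂ) * (π σ⁻¹ : Matrix (Fin m) (Fin m) ℂ) i i) *
      ((m / n.factorial : ℂ) * (π (σ⁻¹ * ρ)⁻¹ : Matrix (Fin m) (Fin m) ℂ) j j) =
      ∑ k, (m / n.factorial : ℂ) ^ 2 * (π ρ⁻¹ : Matrix (Fin m) (Fin m) ℂ) j k *
      ((π σ : Matrix (Fin m) (Fin m) ℂ) k j * (π σ⁻¹ : Matrix (Fin m) (Fin m) ℂ) i i) := by
    intro σ
    rw [mul_inv_rev, inv_inv, apply_mul, Matrix.mul_apply, Finset.mul_sum, Finset.mul_sum]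
    exact Finset.sum_congr rfl fun k _ => by ring
  rw [Finset.sum_congr rfl fun σ _ => this σ, Finset.sum_comm]
  simp only [← Finset.mul_sum, h.sum_mul_apply]
  by_cases hij : i = j
  · subst hij
    simp
    field_simp
  · simp [hij, Ne.symm hij]

theorem IsIrreducible.isSelfAdjointIdempotent_entry {π : UnitaryRep n m} (h : π.IsIrreducible)
    (i : Fin m) : IsSelfAdjointIdempotent (fun σ => (m / n.factorial : ℂ) *
      (π σ⁻¹ : Matrix (Fin m) (Fin m) ℂ) i i) where
  conj_apply σ := by
    simp only [map_mul, map_div₀, map_natCast, UnitaryRep.conj_apply]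
  sum_mul ρ := by rw [h.sum_entry_mul, if_pos rfl]

theorem IsIrreducible.isSelfAdjointIdempotent_sum {π : UnitaryRep n m} (h : π.IsIrreducible) :
    IsSelfAdjointIdempotent (fun σ => ∑ i, (m / n.factorial : ℂ) *
      (π σ⁻¹ : Matrix (Fin m) (Fin m) ℂ) i i) where
  conj_apply σ := by
    simp only [map_sum, map_mul, map_div₀, map_natCast, UnitaryRep.conj_apply]
  sum_mul ρ := by
    simp only [Finset.sum_mul_sum]
    rw [Finset.sum_comm]
    refine Finset.sum_congr rfl fun i _ => ?_
    rw [Finset.sum_comm]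
    simp only [h.sum_entry_mul]
    simp

end UnitaryRep

end PolydiscBergman

/-! ### Joint eigenspaces as invariants of Hilbert modules -/

namespace HilbertModule

variable {R : Type*} [CommRing R] [Algebra ℂ R]
  {H₁ : Type*} [NormedAddCommGroup H₁] [InnerProductSpace ℂ H₁]
  {H₂ : Type*} [NormedAddCommGroup H₂] [InnerProductSpace ℂ H₂]

/-- The joint kernel of the adjoints `(T_r - ev r)^*`. -/
def jointEigenspace (T : HilbertModule R H₁) (ev : R → ℂ) : Submodule ℂ H₁ where
  carrier := {g | ∀ r f, inner ℂ (T r f - ev r • f) g = 0}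
  zero_mem' := by simp
  add_mem' {g h} hg hh r f := by rw [inner_add_right, hg, hh, add_zero]
  smul_mem' c g hg r f := by rw [inner_smul_right, hg, mul_zero]

theorem Equivalent.finrank_jointEigenspace_eq {T₁ : HilbertModule R H₁} {T₂ : HilbertModule R H₂}
    (h : T₁.Equivalent T₂) (ev : R → ℂ) :
    Module.finrank ℂ (T₁.jointEigenspace ev) = Module.finrank ℂ (T₂.jointEigenspace ev) := by
  obtain ⟨U, hU⟩ := h
  have : (T₁.jointEigenspace ev).map (U.toLinearEquiv : H₁ →ₗ[ℂ] H₂) = T₂.jointEigenspace ev := by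
    ext g
    rw [Submodule.mem_map_equiv]
    have key : ∀ r f, inner ℂ (T₁ r f - ev r • f) (U.symm g) =
        inner ℂ (T₂ r (U f) - ev r • U f) g := by
      intro r f
      rw [← U.inner_map_map, map_sub, map_smul, hU, U.apply_symm_apply]
    constructor
    · intro hg r f
      obtain ⟨f, rfl⟩ := U.surjective f
      rw [← key]; exact hg r f
    · intro hg r f
      refine (key r f).trans (hg r _)
  rw [← this]
  exact (LinearEquiv.finrank_map_eq U.toLinearEquiv _).symm

end HilbertModule

namespace PolydiscBergman

open Complex MvPolynomial
open scoped ComplexConjugate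

variable {n : ℕ} {lam : ℝ} [Fact (0 < lam)]

/-! ## Joint eigenspaces at a point with distinct coordinates -/

theorem mulOp_add_apply (p q : MvPolynomial (Fin n) ℂ) (f : BergmanSpace n lam) :
    mulOp (p + q) f = mulOp p f + mulOp q f :=
  RKHS.ext fun z => by simp [add_mul]

theorem mulOp_zero_apply (f : BergmanSpace n lam) :
    mulOp (0 : MvPolynomial (Fin n) ℂ) f = 0 :=
  RKHS.ext fun z => by simp

theorem mulOp_sub_C_apply (p : MvPolynomial (Fin n) ℂ) (c : ℂ) (f : BergmanSpace n lam) :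
    mulOp (p - C c) f = mulOp p f - c • f :=
  RKHS.ext fun z => by simp [sub_mul]

theorem mulOp_sum_C_mul_apply {ι : Type*} (s : Finset ι) (c : ι → ℂ)
    (p : ι → MvPolynomial (Fin n) ℂ) (f : BergmanSpace n lam) :
    mulOp (∑ i ∈ s, C (c i) * p i) f = ∑ i ∈ s, c i • mulOp (p i) f := by
  classical
  induction s using Finset.induction_on with
  | empty => exact mulOp_zero_apply f
  | insert i s hi ih =>
    rw [Finset.sum_insert hi, Finset.sum_insert hi, mulOp_add_apply, ih]
    congr 1
    exact RKHS.ext fun z => by simp [mul_assoc]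

theorem inner_mulOp_constOne_kerFun (p : MvPolynomial (Fin n) ℂ) (w : Polydisc n) :
    inner ℂ (mulOp p (constOne n lam)) (RKHS.kerFun (BergmanSpace n lam) w 1) =
      conj (eval (fun i => (w i : ℂ)) p) := by
  rw [← inner_conj_symm, inner_kerFun_one]
  simp

/-- Evaluation of symmetric polynomials at a point of the polydisc. -/
noncomputable def evalSym (w : Polydisc n) (r : SymPoly n) : ℂ := eval (fun i => (w i : ℂ)) r.1

theorem evalSym_comp_perm (w : Polydisc n) (σ : Equiv.Perm (Fin n)) (r : SymPoly n) :
    evalSym (w ∘ σ) r = evalSym w r := by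
  have h : rename σ r.1 = r.1 := r.2 σ
  rw [evalSym, evalSym]
  conv_rhs => rw [← h, eval_rename]
  rfl

/-- Linear combinations of the kernel functions on the orbit of `w`. -/
noncomputable def orbitMap (lam : ℝ) [Fact (0 < lam)] (w : Polydisc n) :
    (Equiv.Perm (Fin n) → ℂ) →ₗ[ℂ] BergmanSpace n lam :=
  Fintype.linearCombination ℂ fun σ : Equiv.Perm (Fin n) =>
    RKHS.kerFun (BergmanSpace n lam) (w ∘ σ) 1

theorem orbitMap_apply (w : Polydisc n) (c : Equiv.Perm (Fin n) → ℂ) :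
    orbitMap lam w c = ∑ σ, c σ • RKHS.kerFun (BergmanSpace n lam) (w ∘ σ) 1 :=
  Fintype.linearCombination_apply _ _ _

theorem inner_mulOp_constOne_orbitMap (p : MvPolynomial (Fin n) ℂ) (w : Polydisc n)
    (c : Equiv.Perm (Fin n) → ℂ) :
    inner ℂ (mulOp p (constOne n lam)) (orbitMap lam w c) =
      ∑ σ : Equiv.Perm (Fin n), c σ * conj (eval ((fun i => (w i : ℂ)) ∘ σ) p) := by
  rw [orbitMap_apply, inner_sum]
  refine Finset.sum_congr rfl fun σ _ => ?_
  rw [inner_smul_right, inner_mulOp_constOne_kerFun]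
  rfl

variable {w : Polydisc n}

/-- Pairing with the interpolation polynomial `E τ` isolates the coefficient at `τ`. -/
theorem orbitMap_injective (hw : Function.Injective fun i => (w i : ℂ)) :
    Function.Injective (orbitMap lam w) := by
  classical
  rw [injective_iff_map_eq_zero]
  intro c hc
  obtain ⟨E, hE, -⟩ := exists_interpolation hw
  ext τ
  have := inner_mulOp_constOne_orbitMap (lam := lam) (E τ) w c
  rw [hc, inner_zero_right] at this
  simp only [hE] at this
  simpa using this.symm

/-- Symmetric polynomials are constant on the orbit, so its kernel functions are joint eigenvectors.
Conversely, a joint eigenvector is orthogonal to all multiples by `orbitIdeal`, so its pairing with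
a polynomial depends only on the values of that polynomial on the orbit; density then identifies the
vector. -/
theorem range_orbitMap (hw : Function.Injective fun i => (w i : ℂ)) :
    LinearMap.range (orbitMap lam w) = (bergmanModule n lam).jointEigenspace (evalSym w) := by
  apply le_antisymm
  · rintro _ ⟨c, rfl⟩
    rw [orbitMap_apply]
    refine Submodule.sum_mem _ fun σ _ => Submodule.smul_mem _ _ fun r f => ?_
    rw [← inner_conj_symm, inner_kerFun_one, RKHS.coe_sub, RKHS.coe_smul, Pi.sub_apply,
      Pi.smul_apply]
    have h1 : bergmanModule n lam r f (w ∘ σ) = evalSym (w ∘ σ) r * f (w ∘ σ) :=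
      mulOp_apply r.1 f _
    rw [h1, evalSym_comp_perm, smul_eq_mul, sub_self, map_zero]
  · intro g hg
    obtain ⟨E, -, hE⟩ := exists_interpolation hw
    -- All `f` are needed as test vectors: in the induction a polynomial factor is absorbed into
    -- `f`.
    have hI : ∀ p ∈ orbitIdeal (fun i => (w i : ℂ)), ∀ f : BergmanSpace n lam,
        inner ℂ (mulOp p f) g = 0 := by
      intro p hp
      refine Submodule.span_induction ?_ ?_ ?_ ?_ hp
      · rintro _ ⟨r, rfl⟩ f
        rw [mulOp_sub_C_apply]
        exact hg r f
      · intro f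
        rw [mulOp_zero_apply, inner_zero_left]
      · intro p q _ _ h1 h2 f
        rw [mulOp_add_apply, inner_add_left, h1, h2, add_zero]
      · intro a p _ h1 f
        rw [smul_eq_mul, mul_comm, mulOp_mul_apply, h1]
    refine ⟨fun σ => inner ℂ (mulOp (E σ) (constOne n lam)) g, ?_⟩
    rw [← sub_eq_zero]
    refine eq_zero_of_inner_polynomial_eq_zero fun p => ?_
    rw [← inner_conj_symm, inner_sub_right, inner_mulOp_constOne_orbitMap]
    have h2 := hI _ (hE p) (constOne n lam)
    have h3 : mulOp p (constOne n lam) = mulOp (p - ∑ σ : Equiv.Perm (Fin n),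
        C (eval ((fun i => (w i : ℂ)) ∘ σ) p) * E σ) (constOne n lam) +
        ∑ σ : Equiv.Perm (Fin n), eval ((fun i => (w i : ℂ)) ∘ σ) p •
          mulOp (E σ) (constOne n lam) := by
      rw [← mulOp_sum_C_mul_apply, ← mulOp_add_apply, sub_add_cancel]
    rw [h3, inner_add_left, h2, zero_add, sum_inner]
    simp only [inner_smul_left, mul_comm]
    simp

/-- The action of an element of the group algebra on the regular representation. -/
noncomputable def regularOp (a : Equiv.Perm (Fin n) → ℂ) :
    (Equiv.Perm (Fin n) → ℂ) →ₗ[ℂ] Equiv.Perm (Fin n) → ℂ :=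
  Matrix.toLin' (.of fun ρ σ => a (ρ⁻¹ * σ))

theorem trace_regularOp (a : Equiv.Perm (Fin n) → ℂ) :
    LinearMap.trace ℂ _ (regularOp a) = n.factorial * a 1 := by
  rw [regularOp, Matrix.trace_toLin'_eq]
  simp [Matrix.trace, Fintype.card_perm]

/-- `permOp σ` sends the kernel function at `w ∘ τ` to the one at `w ∘ (τ * σ⁻¹)`; solving ρ = τσ⁻¹
for σ explains the index `ρ⁻¹ * σ` in `regularOp`. -/
theorem groupOp_orbitMap (w : Polydisc n) (a c : Equiv.Perm (Fin n) → ℂ) :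
    groupOp lam a (orbitMap lam w c) = orbitMap lam w (regularOp a c) := by
  simp only [groupOp_apply, orbitMap_apply, map_sum, map_smul, permOp_kerFun, regularOp,
    Matrix.toLin'_apply, Matrix.mulVec, dotProduct, Matrix.of_apply, Finset.smul_sum,
    Finset.sum_smul]
  rw [Finset.sum_comm (s := Finset.univ) (t := Finset.univ) (f := fun ρ σ =>
    (a (ρ⁻¹ * σ) * c σ) • RKHS.kerFun (BergmanSpace n lam) (w ∘ ⇑ρ) 1)]
  refine Finset.sum_congr rfl fun σ _ => ?_
  refine Fintype.sum_equiv ((Equiv.inv _).trans (Equiv.mulLeft σ)) _ _ fun τ => ?_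
  simp [mul_smul, Function.comp_assoc, smul_comm (c σ)]

/-- The dimension of the joint eigenspace, at a point with distinct coordinates, of the sub-module
cut out by a self-adjoint idempotent of the group algebra. -/
theorem finrank_jointEigenspace_restrict (hw : Function.Injective fun i => (w i : ℂ))
    {a : Equiv.Perm (Fin n) → ℂ} (ha : IsSelfAdjointIdempotent a)
    {P : BergmanSpace n lam →L[ℂ] BergmanSpace n lam} (hP : P = groupOp lam a)
    (hS : ∀ r, ∀ h ∈ LinearMap.range P.toLinearMap,
      bergmanModule n lam r h ∈ LinearMap.range P.toLinearMap) :
    (Module.finrank ℂ (((bergmanModule n lam).restrict (LinearMap.range P.toLinearMap)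
      hS).jointEigenspace (evalSym w)) : ℂ) = n.factorial * a 1 := by
  have hPP : ∀ f, P (P f) = P f := by
    intro f
    rw [hP, groupOp_comp, funext ha.sum_mul]
  have hQQ : IsIdempotentElem (regularOp a) := by
    refine LinearMap.ext fun c => orbitMap_injective (lam := lam) hw ?_
    rw [Module.End.mul_apply, ← groupOp_orbitMap, ← groupOp_orbitMap, ← hP, hPP]
  -- Since `P` is self-adjoint and commutes with the module action, testing a vector fixed by `P`
  -- against `f` is the same as testing it against `P f`. The eigenspace of the sub-module is thus
  -- the part of the ambient one that `P` fixes.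
  have hmap : (((bergmanModule n lam).restrict (LinearMap.range P.toLinearMap)
      hS).jointEigenspace (evalSym w)).map (LinearMap.range P.toLinearMap).subtype =
      (LinearMap.range (regularOp a)).map (orbitMap lam w) := by
    ext x
    constructor
    · rintro ⟨⟨g, hg⟩, hgD, rfl⟩
      have hPg : P g = g := by obtain ⟨f, rfl⟩ := hg; exact hPP f
      have hgA : g ∈ (bergmanModule n lam).jointEigenspace (evalSym w) := by
        intro r f
        have h1 := hgD r ⟨P f, f, rfl⟩
        rw [← hPg, hP, ← inner_groupOp_left ha.conj_apply, map_sub, map_smul,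
          ← bergmanModule_groupOp, ← hP]
        exact h1
      rw [← range_orbitMap hw] at hgA
      obtain ⟨c, rfl⟩ := hgA
      refine ⟨regularOp a c, ⟨c, rfl⟩, ?_⟩
      rw [← groupOp_orbitMap, ← hP, hPg]
      rfl
    · rintro ⟨_, ⟨c, rfl⟩, rfl⟩
      have h1 : orbitMap lam w (regularOp a c) ∈
          (bergmanModule n lam).jointEigenspace (evalSym w) := by
        rw [← range_orbitMap hw]; exact ⟨_, rfl⟩
      refine ⟨⟨orbitMap lam w (regularOp a c), ?_⟩, fun r f => h1 r f, rfl⟩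
      rw [← groupOp_orbitMap, ← hP]
      exact ⟨_, rfl⟩
  -- The trace of an idempotent is its rank; both inclusions into the Bergman space are injective
  -- and preserve dimension.
  rw [← trace_regularOp, (LinearMap.IsIdempotentElem.isProj_range _ hQQ).trace,
    (Submodule.equivMapOfInjective _ (Submodule.injective_subtype _) _).finrank_eq, hmap,
    ← (Submodule.equivMapOfInjective _ (orbitMap_injective hw) _).finrank_eq]

theorem exists_polydisc_injective (n : ℕ) :
    ∃ w : Polydisc n, Function.Injective fun i => (w i : ℂ) := by
  have h : ∀ i : Fin n, ‖((i : ℕ) / n : ℂ)‖ < 1 := by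
    intro i
    have hn : (0 : ℝ) < n := Nat.cast_pos.2 (Nat.zero_lt_of_lt i.2)
    rw [norm_div, norm_natCast, norm_natCast, div_lt_one hn]
    exact_mod_cast i.2
  refine ⟨fun i => UnitDisc.mk _ (h i), fun i j hij => ?_⟩
  have hn : (n : ℂ) ≠ 0 := Nat.cast_ne_zero.2 (Nat.zero_lt_of_lt i.2).ne'
  simp only [UnitDisc.coe_mk, div_left_inj' hn] at hij
  exact Fin.ext (by exact_mod_cast hij)

/-! ### Eigenspace dimensions of the entry and isotypic sub-modules -/

namespace UnitaryRep

variable {m : ℕ}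

theorem IsIrreducible.finrank_jointEigenspace_entryModule {π : UnitaryRep n m}
    (h : π.IsIrreducible) (hw : Function.Injective fun i => (w i : ℂ)) (i : Fin m) :
    Module.finrank ℂ ((π.entryModule lam i).jointEigenspace (evalSym w)) = m := by
  have h1 := finrank_jointEigenspace_restrict hw (h.isSelfAdjointIdempotent_entry i)
    (π.projEntry_eq_groupOp (lam := lam) i i) (fun p => invariant_range _ _ p)
  have hn : (n.factorial : ℂ) ≠ 0 := Nat.cast_ne_zero.2 n.factorial_ne_zero
  have h2 : (n.factorial : ℂ) * ((m / n.factorial : ℂ) *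
      (π 1⁻¹ : Matrix (Fin m) (Fin m) ℂ) i i) = m := by
    simp
    field_simp
  exact_mod_cast h1.trans h2

theorem IsIrreducible.finrank_jointEigenspace_isotypicModule {π : UnitaryRep n m}
    (h : π.IsIrreducible) (hw : Function.Injective fun i => (w i : ℂ)) :
    Module.finrank ℂ ((π.isotypicModule lam).jointEigenspace (evalSym w)) = m ^ 2 := by
  have h1 := finrank_jointEigenspace_restrict hw h.isSelfAdjointIdempotent_sum
    (π.proj_eq_groupOp (lam := lam)) (fun p => invariant_range _ _ p)
  have hn : (n.factorial : ℂ) ≠ 0 := Nat.cast_ne_zero.2 n.factorial_ne_zero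
  have h2 : (n.factorial : ℂ) * (∑ i, (m / n.factorial : ℂ) *
      (π 1⁻¹ : Matrix (Fin m) (Fin m) ℂ) i i) = (m : ℂ) ^ 2 := by
    simp
    field_simp
  exact_mod_cast h1.trans h2

end UnitaryRep

end PolydiscBergman

theorem theorem4p1 (n : ℕ) (lam : ℝ) [Fact (0 < lam)] {m m' : ℕ}
    (πp : PolydiscBergman.UnitaryRep n m) (πq : PolydiscBergman.UnitaryRep n m')
    (hp : πp.IsIrreducible) (hq : πq.IsIrreducible)
    (hχ : πp.character 1 ≠ πq.character 1) :
    (∀ (i : Fin m) (j : Fin m'),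
      ¬ HilbertModule.Equivalent (πp.entryModule lam i) (πq.entryModule lam j)) ∧
    ¬ HilbertModule.Equivalent (πp.isotypicModule lam) (πq.isotypicModule lam) := by
  have hm : m ≠ m' := fun h => hχ (by
    rw [PolydiscBergman.UnitaryRep.character_one, PolydiscBergman.UnitaryRep.character_one, h])
  obtain ⟨w, hw⟩ := PolydiscBergman.exists_polydisc_injective n
  refine ⟨fun i j h => hm ?_, fun h => hm ?_⟩
  · have := h.finrank_jointEigenspace_eq (PolydiscBergman.evalSym w)
    rwa [hp.finrank_jointEigenspace_entryModule hw, hq.finrank_jointEigenspace_entryModule hw]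
      at this
  · have := h.finrank_jointEigenspace_eq (PolydiscBergman.evalSym w)
    rw [hp.finrank_jointEigenspace_isotypicModule hw,
      hq.finrank_jointEigenspace_isotypicModule hw] at this
    exact Nat.pow_left_injective two_ne_zero this
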